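/- All quantum systems are finite-dimensional, all logarithms are to base two (with $\log 0=-\infty$), and a quantum channel $\mathcal N_{A\to B}$ is a completely positive trace-preserving linear map from operators on $A$ to operators on $B$. Let $\mathcal N_{A\to B}$ and $\mathcal M_{A\to B}$ be quantum channels. For $n\ge 1$, an adaptive $n$-use discrimination protocol $\{Q,\mathcal A\}$ consists of reference systems $R_1,\dots,R_n$ of arbitrary finite dimension, an initial state $\rho_{R_1A_1}=\tau_{R_1A_1}$, channels $\mathcal A^{(i)}_{R_iB_i\to R_{i+1}A_{i+1}}$ for $1\le i<n$, and a final measurement $\{Q,I-Q\}$ on $R_nB_n$ with $0\le Q\le I$. It produces the states $$\rho_{R_iB_i}=\mathcal N_{A_i\to B_i}(\rho_{R_iA_i}),\qquad \rho_{R_{i+1}A_{i+1}}=\mathcal A^{(i)}(\rho_{R_iB_i}),$$ $$\tau_{R_iB_i}=\mathcal M_{A_i\to B_i}(\tau_{R_iA_i}),\qquad \tau_{R_{i+1}A_{i+1}}=\mathcal A^{(i)}(\tau_{R_iB_i}),$$ and has the error probabilities $\alpha_n(\{Q,\mathcal A\})=\operatorname{Tr}[(I-Q)\rho_{R_nB_n}]$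 and $\beta_n(\{Q,\mathcal A\})=\operatorname{Tr}[Q\,\tau_{R_nB_n}]$. For $p\in(0,1)$ the non-asymptotic symmetric error exponent is $$\xi_n(p,\mathcal N,\mathcal M)=\sup_{\{Q,\mathcal A\}}-\frac1n\log\big(p\,\alpha_n(\{Q,\mathcal A\})+(1-p)\,\beta_n(\{Q,\mathcal A\})\big)\in\mathbb R\cup\{+\infty\}.$$ For states $\rho,\sigma$ of one system let $$\widetilde D_{1/2}(\rho\|\sigma)=-2\log\operatorname{Tr}\big[(\sigma^{1/2}\rho\,\sigma^{1/2})^{1/2}\big]\ \text{ if }\operatorname{Tr}[\rho\sigma]\ne0,\qquad \widetilde D_{1/2}(\rho\|\sigma)=+\infty\ \text{ otherwise}$$ (the sandwiched Rényi divergence of order $1/2$), and let $D_{\max}(\rho\|\sigma)=\inf\{\lambda\in\mathbb R:\rho\le 2^{\lambda}\sigma\}$ with $\inf\emptyset=+\infty$ (the max-relative entropy). For channels let $$\widetilde D^{\mathcal A}_{1/2}(\mathcal N\|\mathcal M)=\sup_{\rho_{RA},\sigma_{RA}}\Big[\widetilde D_{1/2}\big(\mathcal N_{A\to B}(\rho_{RA})\,\big\|\,\mathcal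 M_{A\to B}(\sigma_{RA})\big)-\widetilde D_{1/2}(\rho_{RA}\|\sigma_{RA})\Big],$$ $$D_{\max}(\mathcal N\|\mathcal M)=\sup_{\rho_{RA}}D_{\max}\big(\mathcal N_{A\to B}(\rho_{RA})\,\big\|\,\mathcal M_{A\to B}(\rho_{RA})\big),$$ where the suprema are over all reference systems $R$ of arbitrary finite dimension and all states of $RA$; in the first one, pairs with $\widetilde D_{1/2}(\rho_{RA}\|\sigma_{RA})=+\infty$ do not contribute. Then for all $p\in(0,1)$ and all integers $n\ge1$, $$\xi_n(p,\mathcal N,\mathcal M)\le\min\Big\{\widetilde D^{\mathcal A}_{1/2}(\mathcal N\|\mathcal M),\,D_{\max}(\mathcal N\|\mathcal M),\,D_{\max}(\mathcal M\|\mathcal N)\Big\}-\frac1n\log\big[p(1-p)\big].$$ -/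

import Mathlib

/-!
Quantum systems are finite-dimensional; a system `A` is represented by a finite type indexing an
orthonormal basis, operators on `A` are matrices `Matrix A A ℂ`, and a composite system `RA` is
represented by the product type `R × A`. All logarithms are to base two. Reference systems, on
whose dimension there is no bound, are `Fin r` with `r : ℕ` arbitrary. Quantities that may be
infinite take values in `EReal`.
-/

universe u

noncomputable section

namespace ChannelDiscrimination

open scoped ComplexOrder

/-- The density operators of a system. -/
def IsState {X : Type*} [Fintype X] (ρ : Matrix X X ℂ) : Prop :=
  ρ.PosSemidef ∧ ρ.trace = 1

/-- The action of `id_R ⊗ N` on an operator on `RA`: the map `N` is applied to every block. -/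
def idTensor {R A B : Type*} (N : Matrix A A ℂ →ₗ[ℂ] Matrix B B ℂ)
    (X : Matrix (R × A) (R × A) ℂ) : Matrix (R × B) (R × B) ℂ :=
  Matrix.of fun i j => N (Matrix.of fun a a' => X (i.1, a) (j.1, a')) i.2 j.2

/-- `N` is completely positive: `id_R ⊗ N` preserves positive semidefiniteness for all finite-
dimensional `R`. -/
def IsCompletelyPositive {A B : Type*} [Fintype A] [Fintype B]
    (N : Matrix A A ℂ →ₗ[ℂ] Matrix B B ℂ) : Prop :=
  ∀ (r : ℕ) (X : Matrix (Fin r × A) (Fin r × A) ℂ),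
    X.PosSemidef → (idTensor N X).PosSemidef

/-- Quantum channels: completely positive and trace-preserving linear maps. -/
def IsChannel {A B : Type*} [Fintype A] [Fintype B]
    (N : Matrix A A ℂ →ₗ[ℂ] Matrix B B ℂ) : Prop :=
  IsCompletelyPositive N ∧ ∀ X : Matrix A A ℂ, (N X).trace = X.trace

/-- The power `H ^ s` (for `s ≠ 0`) of a positive semidefinite operator by functional calculus.
As `(0 : ℝ) ^ s = 0` for `s ≠ 0`, negative powers are generalized inverses. -/
def opPow {X : Type*} [Fintype X] [DecidableEq X] (H : Matrix X X ℂ) (s : ℝ) : Matrix X X ℂ :=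
  cfc (fun x : ℝ => x ^ s) H

/-- A measure of distinguishability: an extended real number for each pair of operators on each
system. -/
abbrev Divergence : Type (u + 1) :=
  ∀ (X : Type u) [Fintype X] [DecidableEq X], Matrix X X ℂ → Matrix X X ℂ → EReal

open Classical in
/-- The sandwiched Rényi divergence of order `α ∈ (0, 1) ∪ (1, ∞)`. It is finite if `α < 1` and
the states are not orthogonal, or if `α > 1` and `supp ρ ⊆ supp σ`; the support of a Hermitian
matrix is its range. -/
def sandwichedRenyi (α : ℝ) : Divergence.{u} := fun _ _ _ ρ σ =>
  if (0 < α ∧ α < 1 ∧ (ρ * σ).trace ≠ 0) ∨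
      (1 < α ∧ LinearMap.range ρ.mulVecLin ≤ LinearMap.range σ.mulVecLin) then
    ((1 / (α - 1) * Real.logb 2 (Matrix.trace (opPow
      (opPow σ ((1 - α) / (2 * α)) * ρ * opPow σ ((1 - α) / (2 * α))) α)).re : ℝ) : EReal)
  else ⊤

/-- The max-relative entropy `inf {x : ρ ≤ 2 ^ x • σ}`, with `inf ∅ = ∞`. -/
def maxRelEntropy : Divergence.{u} := fun _ _ _ ρ σ =>
  ⨅ (x : ℝ) (_ : ((2 : ℝ) ^ x • σ - ρ).PosSemidef), (x : EReal)

/-- The channel divergence: the supremum of `D (N(ρ_RA) ‖ M(ρ_RA))` over all states `ρ_RA` and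
all reference systems `R`. -/
def channelDivergence (D : Divergence.{u}) {A B : Type u}
    [Fintype A] [DecidableEq A] [Fintype B] [DecidableEq B]
    (N M : Matrix A A ℂ →ₗ[ℂ] Matrix B B ℂ) : EReal :=
  ⨆ (r : ℕ) (ρ : Matrix (Fin r × A) (Fin r × A) ℂ) (_ : IsState ρ),
    D (Fin r × B) (idTensor N ρ) (idTensor M ρ)

/-- The amortized channel divergence: the supremum of
`D (N(ρ_RA) ‖ M(σ_RA)) - D (ρ_RA ‖ σ_RA)` over all pairs of states `ρ_RA`, `σ_RA` and all
reference systems `R`. Pairs with `D (ρ_RA ‖ σ_RA) = ∞` do not contribute, since in `EReal` the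
difference is then `-∞`, also when the minuend is `∞`. -/
def amortizedChannelDivergence (D : Divergence.{u}) {A B : Type u}
    [Fintype A] [DecidableEq A] [Fintype B] [DecidableEq B]
    (N M : Matrix A A ℂ →ₗ[ℂ] Matrix B B ℂ) : EReal :=
  ⨆ (r : ℕ) (ρ : Matrix (Fin r × A) (Fin r × A) ℂ) (σ : Matrix (Fin r × A) (Fin r × A) ℂ)
    (_ : IsState ρ) (_ : IsState σ),
    D (Fin r × B) (idTensor N ρ) (idTensor M σ) - D (Fin r × A) ρ σ

/-- An adaptive protocol for the discrimination of two channels from `A` to `B` with `n ≥ 1` uses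
of the unknown channel. The uses are numbered `0, …, n - 1`, and the `i`-th one acts on the system
`R_i A` with `R_i = Fin (r i)`. Only `r i` with `i < n` and `adapt i` with `i + 1 < n` matter. -/
structure Protocol (A B : Type u) [Fintype A] [DecidableEq A] [Fintype B] [DecidableEq B]
    (n : ℕ) where
  /-- dimensions of the reference systems -/
  r : ℕ → ℕ
  /-- the initial state of `R_0 A` -/
  init : Matrix (Fin (r 0) × A) (Fin (r 0) × A) ℂ
  init_isState : IsState init
  /-- the channel applied between the uses `i` and `i + 1` -/
  adapt : ∀ i : ℕ, Matrix (Fin (r i) × B) (Fin (r i) × B) ℂ →ₗ[ℂ]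
    Matrix (Fin (r (i + 1)) × A) (Fin (r (i + 1)) × A) ℂ
  adapt_isChannel : ∀ i : ℕ, i + 1 < n → IsChannel (adapt i)
  /-- the final measurement is `{Q, 1 - Q}` -/
  Q : Matrix (Fin (r (n - 1)) × B) (Fin (r (n - 1)) × B) ℂ
  Q_nonneg : Q.PosSemidef
  Q_le_one : (1 - Q).PosSemidef

namespace Protocol

variable {A B : Type u} [Fintype A] [DecidableEq A] [Fintype B] [DecidableEq B] {n : ℕ}

/-- The state of `R_i A` just before the use `i`, if the unknown channel is `N`. -/
def stateBefore (P : Protocol A B n) (N : Matrix A A ℂ →ₗ[ℂ] Matrix B B ℂ) :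
    (i : ℕ) → Matrix (Fin (P.r i) × A) (Fin (P.r i) × A) ℂ
  | 0 => P.init
  | i + 1 => P.adapt i (idTensor N (stateBefore P N i))

/-- The state of `R_{n-1} B` after the last use, if the unknown channel is `N`. -/
def finalState (P : Protocol A B n) (N : Matrix A A ℂ →ₗ[ℂ] Matrix B B ℂ) :
    Matrix (Fin (P.r (n - 1)) × B) (Fin (P.r (n - 1)) × B) ℂ :=
  idTensor N (P.stateBefore N (n - 1))

/-- The type I error probability: the channel is `N`, the outcome is `1 - Q`. -/
def typeIError (P : Protocol A B n) (N : Matrix A A ℂ →ₗ[ℂ] Matrix B B ℂ) : ℝ :=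
  (Matrix.trace ((1 - P.Q) * P.finalState N)).re

/-- The type II error probability: the channel is `M`, the outcome is `Q`. -/
def typeIIError (P : Protocol A B n) (M : Matrix A A ℂ →ₗ[ℂ] Matrix B B ℂ) : ℝ :=
  (Matrix.trace (P.Q * P.finalState M)).re

end Protocol

open Classical in
/-- The binary logarithm of a nonnegative real number, with `log 0 = -∞`. -/
def elog2 (x : ℝ) : EReal := if x ≤ 0 then ⊥ else (Real.logb 2 x : EReal)

/-- The non-asymptotic symmetric error exponent `ξ_n(p, N, M)`: the supremum over all `n`-use
adaptive protocols of `-(1/n) log (p α_n + (1 - p) β_n)`. -/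
def symmetricErrorExponent {A B : Type u}
    [Fintype A] [DecidableEq A] [Fintype B] [DecidableEq B]
    (n : ℕ) (p : ℝ) (N M : Matrix A A ℂ →ₗ[ℂ] Matrix B B ℂ) : EReal :=
  ⨆ P : Protocol A B n,
    -(((1 / (n : ℝ) : ℝ) : EReal) * elog2 (p * P.typeIError N + (1 - p) * P.typeIIError M))

end ChannelDiscrimination

end

/-! Write `F` for the root fidelity, so that the sandwiched divergence of order 1/2 is `-2 log F`.
For real `x` at least the amortized divergence, one use of the channel shrinks `F` by a factor no
smaller than `2 ^ (-x / 2)`, and the channels in between do not decrease it. Hence the final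
fidelity is at least `2 ^ (-n * x / 2)`, and `rootFidelity_sq_le` bounds the error probability below
by `p (1 - p) F ^ 2`. For max-relative entropies the invariant is an operator inequality: each use
multiplies the constant `c` in `ρ ≤ c τ` by at most `2 ^ x`, and domination of the final states
forces an error of at least `p (1 - p) / c`. Exchanging the hypotheses gives the third bound. All
facts on `F` come from one variational formula: `F` is the maximum of `Re Tr Y` over positive blocks
`[[ρ, Y], [Yᴴ, σ]]`. Completely positive maps preserve such blocks, which gives monotonicity, and
testing the blocks gives the measurement bound. -/

open scoped ComplexOrder

namespace ChannelDiscrimination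

/-! ### Functional calculus of positive matrices -/

section FunctionalCalculus

variable {X : Type*} [Fintype X] {H : Matrix X X ℂ}

lemma trace_re_nonneg (hH : H.PosSemidef) : 0 ≤ H.trace.re :=
  (Complex.le_def.1 hH.trace_nonneg).1

lemma trace_conjTranspose_re (Y : Matrix X X ℂ) : Y.conjTranspose.trace.re = Y.trace.re := by
  rw [Matrix.trace_conjTranspose]; simp

variable [DecidableEq X]

lemma continuousOn_spectrum (H : Matrix X X ℂ) (f : ℝ → ℝ) : ContinuousOn f (spectrum ℝ H) :=
  (Matrix.finite_real_spectrum (A := H)).continuousOn f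

lemma spectrum_nonneg (hH : H.PosSemidef) {x : ℝ} (hx : x ∈ spectrum ℝ H) : 0 ≤ x := by
  rw [hH.1.spectrum_real_eq_range_eigenvalues] at hx
  obtain ⟨i, rfl⟩ := hx
  exact hH.eigenvalues_nonneg i

lemma cfc_mul_cfc (f g : ℝ → ℝ) : cfc f H * cfc g H = cfc (fun x => f x * g x) H :=
  (cfc_mul f g H (continuousOn_spectrum H f) (continuousOn_spectrum H g)).symm

lemma cfc_add_cfc (f g : ℝ → ℝ) : cfc f H + cfc g H = cfc (fun x => f x + g x) H :=
  (cfc_add (a := H) f g (continuousOn_spectrum H f) (continuousOn_spectrum H g)).symm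

lemma cfc_sub_cfc (f g : ℝ → ℝ) : cfc f H - cfc g H = cfc (fun x => f x - g x) H :=
  (cfc_sub f g H (continuousOn_spectrum H f) (continuousOn_spectrum H g)).symm

lemma cfc_isHermitian (f : ℝ → ℝ) : (cfc f H).IsHermitian :=
  cfc_predicate (p := IsSelfAdjoint) f H

lemma cfc_congr_nonneg (hH : H.PosSemidef) {f g : ℝ → ℝ} (h : ∀ x, 0 ≤ x → f x = g x) :
    cfc f H = cfc g H :=
  cfc_congr fun _ hx => h _ (spectrum_nonneg hH hx)

lemma cfc_posSemidef (hH : H.PosSemidef) {f : ℝ → ℝ} (h : ∀ x, 0 ≤ x → 0 ≤ f x) :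
    (cfc f H).PosSemidef := by
  have : cfc f H = (cfc (fun x => √(f x)) H).conjTranspose * cfc (fun x => √(f x)) H := by
    rw [(cfc_isHermitian _).eq, cfc_mul_cfc]
    exact cfc_congr_nonneg hH fun x hx => (Real.mul_self_sqrt (h x hx)).symm
  rw [this]
  exact Matrix.posSemidef_conjTranspose_mul_self _

lemma cfc_eq_self (hH : H.PosSemidef) : cfc (fun x : ℝ => x) H = H :=
  cfc_id' ℝ H hH.1

lemma cfc_const_eq (hH : H.PosSemidef) (c : ℝ) :
    cfc (fun _ : ℝ => c) H = (c : ℂ) • (1 : Matrix X X ℂ) := by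
  rw [cfc_const c H (show IsSelfAdjoint H from hH.1), Algebra.algebraMap_eq_smul_one]
  ext i j; simp [Matrix.smul_apply]

lemma cfc_mul_self_mul_cfc (hH : H.PosSemidef) (f : ℝ → ℝ) :
    cfc f H * H * cfc f H = cfc (fun x => f x * x * f x) H := by
  conv_lhs => enter [1, 2]; rw [← cfc_eq_self hH]
  rw [cfc_mul_cfc, cfc_mul_cfc]

lemma opPow_half (H : Matrix X X ℂ) : opPow H (1 / 2) = cfc (fun x : ℝ => √x) H := by
  simp only [opPow, Real.sqrt_eq_rpow]

lemma exists_eq_conjTranspose_mul_self (hH : H.PosSemidef) :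
    ∃ C : Matrix X X ℂ, H = C.conjTranspose * C := by
  refine ⟨cfc (fun x : ℝ => √x) H, ?_⟩
  rw [(cfc_isHermitian _).eq, cfc_mul_cfc,
    cfc_congr_nonneg hH fun x hx => Real.mul_self_sqrt hx, cfc_eq_self hH]

end FunctionalCalculus

/-! ### Variational formula for the root fidelity -/

section Fidelity

variable {X : Type*} [Fintype X] {ρ σ Y : Matrix X X ℂ}

/-- The operators `Y` for which the block operator `[[ρ, Y], [Yᴴ, σ]]` is positive. -/
def IsPosBlock (ρ Y σ : Matrix X X ℂ) : Prop :=
  (Matrix.fromBlocks ρ Y Y.conjTranspose σ).PosSemidef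

/-- Compress the block to the column `(C, -D)` and take traces; the two cross terms are adjoint to
each other. -/
lemma IsPosBlock.two_mul_re_trace_le (h : IsPosBlock ρ Y σ) (C D : Matrix X X ℂ) :
    2 * (C.conjTranspose * Y * D).trace.re ≤
      (C.conjTranspose * ρ * C).trace.re + (D.conjTranspose * σ * D).trace.re := by
  have h1 := trace_re_nonneg (h.conjTranspose_mul_mul_same (Matrix.fromRows C (-D)))
  have h2 := trace_conjTranspose_re (C.conjTranspose * Y * D)
  simp only [Matrix.conjTranspose_mul, Matrix.conjTranspose_conjTranspose] at h2
  rw [Matrix.conjTranspose_fromRows_eq_fromCols_conjTranspose, Matrix.fromCols_mul_fromBlocks,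
    Matrix.fromCols_mul_fromRows] at h1
  simp only [Matrix.conjTranspose_neg, Matrix.add_mul, Matrix.mul_neg, Matrix.neg_mul,
    Matrix.trace_add, Matrix.trace_neg, Complex.add_re, Complex.neg_re, Matrix.mul_assoc] at h1 h2 ⊢
  linarith

variable [DecidableEq X]

/-- The square root of the fidelity, `Tr[(σ^{1/2} ρ σ^{1/2})^{1/2}]`. -/
noncomputable def rootFidelity (ρ σ : Matrix X X ℂ) : ℝ :=
  (Matrix.trace (opPow (opPow σ (1 / 2) * ρ * opPow σ (1 / 2)) (1 / 2))).re

lemma sqrt_conj_posSemidef (hρ : ρ.PosSemidef) (σ : Matrix X X ℂ) :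
    (opPow σ (1 / 2) * ρ * opPow σ (1 / 2)).PosSemidef := by
  have := hρ.conjTranspose_mul_mul_same (opPow σ (1 / 2))
  rwa [show (opPow σ (1 / 2)).conjTranspose = opPow σ (1 / 2) from (cfc_isHermitian _).eq] at this

lemma le_of_forall_pos_le_quadratic {x a b c : ℝ} (h : ∀ δ : ℝ, 0 < δ → x ≤ a + δ * b + δ ^ 2 * c) :
    x ≤ a := by
  have hc : ContinuousAt (fun δ : ℝ => a + δ * b + δ ^ 2 * c) 0 := by fun_prop
  have ht : Filter.Tendsto (fun δ : ℝ => a + δ * b + δ ^ 2 * c) (nhdsWithin 0 (Set.Ioi 0))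
      (nhds a) := by
    simpa using hc.tendsto.mono_left nhdsWithin_le_nhds
  exact ge_of_tendsto ht (eventually_nhdsWithin_of_forall fun δ hδ => h δ hδ)

/-- With `K = σ^{1/2} ρ σ^{1/2}`, the formal choice `C = σ^{1/2} K^{-1/4}`, `D = σ^{-1/2} K^{1/4}`
in `two_mul_re_trace_le` turns the left side into `2 Re Tr Y` and bounds each term on the right by
`Tr √K`. Shifts `ε` of `√K` and `δ` of `√σ` make the inverses exist. -/
theorem IsPosBlock.re_trace_le_rootFidelity (hρ : ρ.PosSemidef) (hσ : σ.PosSemidef)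
    (h : IsPosBlock ρ Y σ) : Y.trace.re ≤ rootFidelity ρ σ := by
  unfold rootFidelity
  have hK := sqrt_conj_posSemidef hρ σ
  set S := opPow σ (1 / 2) with hS
  set K := S * ρ * S with hKdef
  rw [opPow_half] at hS
  rw [opPow_half]
  -- The zero term pads the bound to the shape of `le_of_forall_pos_le_quadratic`.
  suffices ∀ ε : ℝ, 0 < ε → 2 * Y.trace.re ≤ 2 * (cfc (fun x : ℝ => √x) K).trace.re +
      ε * (1 : Matrix X X ℂ).trace.re + ε ^ 2 * 0 by
    linarith [le_of_forall_pos_le_quadratic this]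
  intro ε hε
  set T := cfc (fun x : ℝ => (√(√x + ε))⁻¹) K with hT
  set T' := cfc (fun x : ℝ => √(√x + ε)) K with hT'
  have hpos (x : ℝ) : 0 < √x + ε := by positivity
  have hTT' : T' * T = 1 := by
    rw [hT, hT', cfc_mul_cfc, cfc_congr_nonneg (g := fun _ => 1) hK, cfc_const_eq hK]
    · simp
    · intro x _
      exact mul_inv_cancel₀ (Real.sqrt_pos.2 (hpos x)).ne'
  have hT'2 : (T' * T').trace.re =
      (cfc (fun x : ℝ => √x) K).trace.re + ε * (1 : Matrix X X ℂ).trace.re := by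
    rw [hT', cfc_mul_cfc, cfc_congr_nonneg (g := fun x => √x + ε) hK, ← cfc_add_cfc,
      cfc_const_eq hK]
    · simp only [Matrix.trace_add, Matrix.trace_smul, Complex.add_re, smul_eq_mul,
        Complex.re_ofReal_mul]
    · intro x _
      exact Real.mul_self_sqrt (hpos x).le
  have hTKT : (T * K * T).trace.re ≤ (cfc (fun x : ℝ => √x) K).trace.re := by
    have : T * K * T = cfc (fun x : ℝ => (√x + ε)⁻¹ * x) K := by
      rw [hT, cfc_mul_self_mul_cfc hK]
      refine cfc_congr_nonneg hK fun x _ => ?_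
      rw [mul_right_comm, ← mul_inv, Real.mul_self_sqrt (hpos x).le]
    rw [this, ← sub_nonneg, ← Complex.sub_re, ← Matrix.trace_sub, cfc_sub_cfc]
    refine trace_re_nonneg (cfc_posSemidef hK fun x hx => ?_)
    rw [sub_nonneg, inv_mul_le_iff₀ (hpos x)]
    nlinarith [Real.mul_self_sqrt hx, Real.sqrt_nonneg x]
  suffices ∀ δ : ℝ, 0 < δ → 2 * Y.trace.re ≤ ((T * K * T).trace.re + (T' * T').trace.re) +
      δ * ((T * (S * ρ + ρ * S) * T).trace.re) + δ ^ 2 * (T * ρ * T).trace.re by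
    linarith [le_of_forall_pos_le_quadratic this]
  intro δ hδ
  set L := cfc (fun x : ℝ => √x + δ) σ with hL
  set L' := cfc (fun x : ℝ => (√x + δ)⁻¹) σ with hL'
  have hposδ (x : ℝ) : 0 < √x + δ := by positivity
  have hLS : L = S + (δ : ℂ) • (1 : Matrix X X ℂ) := by
    rw [hL, ← cfc_add_cfc, cfc_const_eq hσ, hS]
  have hLL' : L * L' = 1 := by
    rw [hL, hL', cfc_mul_cfc, cfc_congr_nonneg (g := fun _ => 1) hσ, cfc_const_eq hσ]
    · simp
    · intro x _
      exact mul_inv_cancel₀ (hposδ x).ne'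
  have hTH : T.conjTranspose = T := (cfc_isHermitian _).eq
  have hT'H : T'.conjTranspose = T' := (cfc_isHermitian _).eq
  have hLH : L.conjTranspose = L := (cfc_isHermitian _).eq
  have hL'H : L'.conjTranspose = L' := (cfc_isHermitian _).eq
  have key := h.two_mul_re_trace_le (L * T) (L' * T')
  rw [Matrix.conjTranspose_mul, Matrix.conjTranspose_mul, hTH, hT'H, hLH, hL'H] at key
  have e1 : (T * L * Y * (L' * T')).trace = Y.trace := by
    rw [Matrix.trace_mul_comm, ← Matrix.mul_assoc, ← Matrix.mul_assoc, Matrix.mul_assoc L',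
      hTT', Matrix.mul_one, mul_eq_one_comm.1 hLL', Matrix.one_mul]
  have e2 : (T * L * ρ * (L * T)).trace.re = (T * K * T).trace.re +
      δ * (T * (S * ρ + ρ * S) * T).trace.re + δ ^ 2 * (T * ρ * T).trace.re := by
    have : T * L * ρ * (L * T) = T * K * T + (δ : ℂ) • (T * (S * ρ + ρ * S) * T) +
        ((δ ^ 2 : ℝ) : ℂ) • (T * ρ * T) := by
      rw [hLS, hKdef]
      simp only [Matrix.mul_add, Matrix.add_mul, Matrix.mul_smul, Matrix.smul_mul, Matrix.mul_one,
        Matrix.one_mul, smul_add, smul_smul, Matrix.mul_assoc]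
      push_cast
      rw [sq]
      abel
    rw [this]
    simp only [Matrix.trace_add, Matrix.trace_smul, Complex.add_re, smul_eq_mul,
        Complex.re_ofReal_mul]
  have e3 : (T' * L' * σ * (L' * T')).trace.re ≤ (T' * T').trace.re := by
    have e : L' * σ * L' = cfc (fun x : ℝ => (√x + δ)⁻¹ * x * (√x + δ)⁻¹) σ :=
      cfc_mul_self_mul_cfc hσ _
    have e' : (1 - L' * σ * L').PosSemidef := by
      have h1 : (1 : Matrix X X ℂ) = cfc (fun _ : ℝ => (1 : ℝ)) σ := by simp [cfc_const_eq hσ]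
      rw [e, h1, cfc_sub_cfc]
      refine cfc_posSemidef hσ fun x hx => ?_
      rw [sub_nonneg, ← div_eq_mul_inv, inv_mul_eq_div, div_div, div_le_one (by positivity)]
      nlinarith [Real.mul_self_sqrt hx, Real.sqrt_nonneg x]
    have := trace_re_nonneg (e'.conjTranspose_mul_mul_same T')
    rw [hT'H, Matrix.mul_sub, Matrix.sub_mul, Matrix.mul_one, Matrix.trace_sub,
      Complex.sub_re] at this
    simp only [Matrix.mul_assoc] at this ⊢
    linarith
  rw [e1, e2] at key
  linarith

/-- The optimum is `Y = √ρ W √σ`, where `W = √ρ √σ K^{-1/2}` (generalized inverse) is the polar part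
of `√ρ √σ`. -/
theorem exists_isPosBlock_trace_eq_rootFidelity (hρ : ρ.PosSemidef) (hσ : σ.PosSemidef) :
    ∃ Y, IsPosBlock ρ Y σ ∧ Y.trace.re = rootFidelity ρ σ := by
  unfold rootFidelity
  have hK := sqrt_conj_posSemidef hρ σ
  rw [opPow_half]
  set S := opPow σ (1 / 2) with hS
  set K := S * ρ * S with hKdef
  rw [opPow_half] at hS
  set R := cfc (fun x : ℝ => √x) ρ with hR
  set G := cfc (fun x : ℝ => (√x)⁻¹) K with hG
  have hSH : S.conjTranspose = S := (cfc_isHermitian _).eq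
  have hRH : R.conjTranspose = R := (cfc_isHermitian _).eq
  have hGH : G.conjTranspose = G := (cfc_isHermitian _).eq
  have hSS : S * S = σ := by
    rw [hS, cfc_mul_cfc, cfc_congr_nonneg hσ fun x hx => Real.mul_self_sqrt hx, cfc_eq_self hσ]
  have hRR : R * R = ρ := by
    rw [hR, cfc_mul_cfc, cfc_congr_nonneg hρ fun x hx => Real.mul_self_sqrt hx, cfc_eq_self hρ]
  have hKG : K * G = cfc (fun x : ℝ => √x) K := by
    nth_rw 1 [← cfc_eq_self hK]
    rw [hG, cfc_mul_cfc]
    exact cfc_congr_nonneg hK fun x hx => by rw [← div_eq_mul_inv, Real.div_sqrt]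
  have hW : (1 - G * K * G).PosSemidef := by
    have h1 : (1 : Matrix X X ℂ) = cfc (fun _ : ℝ => (1 : ℝ)) K := by simp [cfc_const_eq hK]
    rw [Matrix.mul_assoc, hKG, hG, cfc_mul_cfc, h1, cfc_sub_cfc]
    exact cfc_posSemidef hK fun x hx => sub_nonneg.2 (inv_mul_le_one)
  refine ⟨R * (R * S * G) * S, ?_, ?_⟩
  -- The block is the Gram matrix of `(√ρ, W √σ)` plus the defect `√σ (1 - WᴴW) √σ` in the lower
  -- corner, and `WᴴW = G K G ≤ 1`.
  · have h1 := (Matrix.posSemidef_conjTranspose_mul_self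
      (Matrix.fromCols R (R * S * G * S))).add
      (hW.conjTranspose_mul_mul_same (Matrix.fromCols (0 : Matrix X X ℂ) S))
    unfold IsPosBlock
    convert h1 using 1
    rw [Matrix.conjTranspose_fromCols_eq_fromRows_conjTranspose,
      Matrix.conjTranspose_fromCols_eq_fromRows_conjTranspose, Matrix.fromRows_mul_fromCols,
      Matrix.fromRows_mul, Matrix.fromRows_mul_fromCols, Matrix.fromBlocks_add]
    simp only [Matrix.conjTranspose_mul, hRH, hSH, hGH, Matrix.conjTranspose_zero, Matrix.zero_mul,
      Matrix.mul_zero, add_zero, hRR]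
    congr 1
    · simp only [Matrix.mul_assoc]
    · simp only [Matrix.mul_assoc]
    · rw [hKdef, ← hRR]
      simp only [Matrix.mul_sub, Matrix.sub_mul, Matrix.mul_one, Matrix.mul_assoc, hSS]
      abel
  · rw [← hKG, Matrix.trace_mul_comm, hKdef, ← hRR]
    simp only [Matrix.mul_assoc]

lemma rootFidelity_nonneg (hρ : ρ.PosSemidef) (σ : Matrix X X ℂ) : 0 ≤ rootFidelity ρ σ := by
  have hK := sqrt_conj_posSemidef hρ σ
  unfold rootFidelity
  rw [opPow_half]
  exact trace_re_nonneg (cfc_posSemidef hK fun x _ => Real.sqrt_nonneg x)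

lemma rootFidelity_self (hρ : ρ.PosSemidef) : ρ.trace.re ≤ rootFidelity ρ ρ := by
  refine IsPosBlock.re_trace_le_rootFidelity hρ hρ ?_
  obtain ⟨V, rfl⟩ := exists_eq_conjTranspose_mul_self hρ
  have := Matrix.posSemidef_conjTranspose_mul_self (Matrix.fromCols V V)
  rw [Matrix.conjTranspose_fromCols_eq_fromRows_conjTranspose, Matrix.fromRows_mul_fromCols] at this
  simpa [IsPosBlock] using this

/-- Matches zero fidelity with the infinite branch of `sandwichedRenyi`: the traces of the positive
operators `√K` and `K` vanish together. -/
lemma rootFidelity_eq_zero_iff (hρ : ρ.PosSemidef) (hσ : σ.PosSemidef) :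
    rootFidelity ρ σ = 0 ↔ (ρ * σ).trace = 0 := by
  have hK := sqrt_conj_posSemidef hρ σ
  have hP := cfc_posSemidef hK fun x _ => Real.sqrt_nonneg x
  have ht : (opPow σ (1 / 2) * ρ * opPow σ (1 / 2)).trace = (ρ * σ).trace := by
    rw [Matrix.trace_mul_comm, ← Matrix.mul_assoc, opPow_half, cfc_mul_cfc,
      cfc_congr_nonneg hσ fun x hx => Real.mul_self_sqrt hx, cfc_eq_self hσ, Matrix.trace_mul_comm]
  rw [← ht, hK.trace_eq_zero_iff]
  unfold rootFidelity
  rw [opPow_half]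
  constructor
  · intro h
    have h0 : (cfc (fun x : ℝ => √x) (opPow σ (1 / 2) * ρ * opPow σ (1 / 2))) = 0 := by
      rw [← hP.trace_eq_zero_iff]
      exact Complex.ext h (Complex.le_def.1 hP.trace_nonneg).2.symm
    rw [← cfc_eq_self hK, ← cfc_congr_nonneg hK fun x hx => Real.mul_self_sqrt hx, ← cfc_mul_cfc,
      h0, Matrix.zero_mul]
  · intro h
    rw [h, cfc_apply_zero]
    simp

end Fidelity

/-! ### Extension by a reference system -/

section IdTensor

variable {R A B : Type*} (N : Matrix A A ℂ →ₗ[ℂ] Matrix B B ℂ)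

lemma idTensor_smul_sub (c : ℝ) (V W : Matrix (R × A) (R × A) ℂ) :
    idTensor N (c • V - W) = c • idTensor N V - idTensor N W := by
  ext i j
  have h : (Matrix.of fun a a' => (c • V - W) (i.1, a) (j.1, a')) =
      (c : ℂ) • (Matrix.of fun a a' => V (i.1, a) (j.1, a')) -
        Matrix.of fun a a' => W (i.1, a) (j.1, a') := by
    ext a a'
    simp
  change N (Matrix.of fun a a' => (c • V - W) (i.1, a) (j.1, a')) i.2 j.2 = _
  rw [h, map_sub, map_smul]
  rfl

lemma trace_idTensor [Fintype R] [Fintype A] [Fintype B]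
    (hN : ∀ V : Matrix A A ℂ, (N V).trace = V.trace) (V : Matrix (R × A) (R × A) ℂ) :
    (idTensor N V).trace = V.trace := by
  simp only [Matrix.trace, Matrix.diag, Fintype.sum_prod_type]
  exact Finset.sum_congr rfl fun i _ => hN (Matrix.of fun a a' => V (i, a) (i, a'))

end IdTensor

/-! ### Channels and positivity -/

section Channel

variable {A B : Type*} [Fintype A] [Fintype B] {N : Matrix A A ℂ →ₗ[ℂ] Matrix B B ℂ}

lemma IsCompletelyPositive.posSemidef_apply (hN : IsCompletelyPositive N) {V : Matrix A A ℂ}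
    (hV : V.PosSemidef) : (N V).PosSemidef :=
  (hN 1 (V.submatrix Prod.snd Prod.snd) (hV.submatrix _)).submatrix fun b => (0, b)

/-- A two-by-two block operator is an operator on a qubit reference times `A`. -/
lemma IsCompletelyPositive.isPosBlock (hN : IsCompletelyPositive N) {ρ Y σ : Matrix A A ℂ}
    (h : IsPosBlock ρ Y σ) : IsPosBlock (N ρ) (N Y) (N σ) := by
  have h1 := (hN 2 _ (h.submatrix fun x : Fin 2 × A =>
    if x.1 = 0 then Sum.inl x.2 else Sum.inr x.2)).submatrix
      (Sum.elim (fun b => (0, b)) (fun b => (1, b)))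
  have h2 : (Matrix.fromBlocks (N ρ) (N Y) (N Y.conjTranspose) (N σ)).PosSemidef := by
    convert h1 using 1
    ext (i | i) (j | j) <;> rfl
  -- Hermiticity of the output block yields that `N` commutes with the adjoint on `Y`.
  have h3 := (Matrix.isHermitian_fromBlocks_iff.1 h2.1).2.1
  rwa [← h3] at h2

lemma IsChannel.isState_apply (hN : IsChannel N) {ρ : Matrix A A ℂ} (hρ : IsState ρ) :
    IsState (N ρ) :=
  ⟨hN.1.posSemidef_apply hρ.1, (hN.2 ρ).trans hρ.2⟩

lemma IsChannel.isState_idTensor (hN : IsChannel N) {r : ℕ} {ρ : Matrix (Fin r × A) (Fin r × A) ℂ}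
    (hρ : IsState ρ) : IsState (idTensor N ρ) :=
  ⟨hN.1 r ρ hρ.1, (trace_idTensor N hN.2 ρ).trans hρ.2⟩

/-- Chain `N(ρ) ≤ c M(ρ) ≤ c d M(σ)`. -/
lemma IsChannel.smul_idTensor_sub_posSemidef {M : Matrix A A ℂ →ₗ[ℂ] Matrix B B ℂ}
    (hM : IsChannel M) {r : ℕ} {ρ σ : Matrix (Fin r × A) (Fin r × A) ℂ} {c d : ℝ}
    (h : (d • σ - ρ).PosSemidef) (hρ : (c • idTensor M ρ - idTensor N ρ).PosSemidef)
    (hc : 0 ≤ c) : ((d * c) • idTensor M σ - idTensor N ρ).PosSemidef := by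
  have h1 := hM.1 r _ h
  rw [idTensor_smul_sub] at h1
  have := (h1.smul hc).add hρ
  rwa [smul_sub, smul_smul, mul_comm c d, sub_add_sub_cancel] at this

/-- Monotonicity of the fidelity under channels. -/
theorem IsChannel.rootFidelity_le [DecidableEq A] [DecidableEq B] (hN : IsChannel N)
    {ρ σ : Matrix A A ℂ} (hρ : ρ.PosSemidef) (hσ : σ.PosSemidef) :
    rootFidelity ρ σ ≤ rootFidelity (N ρ) (N σ) := by
  obtain ⟨Y, hY, h⟩ := exists_isPosBlock_trace_eq_rootFidelity hρ hσ
  rw [← h, ← hN.2 Y]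
  exact (hN.1.isPosBlock hY).re_trace_le_rootFidelity (hN.1.posSemidef_apply hρ)
    (hN.1.posSemidef_apply hσ)

end Channel

/-! ### Lower bounds on the error of a test -/

section Measurement

variable {X : Type*} [Fintype X] {ρ σ E F Y : Matrix X X ℂ}

lemma trace_conjTranspose_mul_self_mul (C V : Matrix X X ℂ) :
    (C.conjTranspose * C * V).trace = (C * V * C.conjTranspose).trace := by
  rw [Matrix.trace_mul_comm (C * V), Matrix.mul_assoc]

variable [DecidableEq X]

lemma re_trace_mul_nonneg (hE : E.PosSemidef) (hρ : ρ.PosSemidef) : 0 ≤ (E * ρ).trace.re := by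
  obtain ⟨C, rfl⟩ := exists_eq_conjTranspose_mul_self hE
  rw [trace_conjTranspose_mul_self_mul]
  exact trace_re_nonneg (hρ.mul_mul_conjTranspose_same C)

lemma IsPosBlock.two_mul_re_trace_mul_le (h : IsPosBlock ρ Y σ) (hE : E.PosSemidef) {u : ℝ}
    (hu : 0 < u) :
    2 * (E * Y).trace.re ≤ u * (E * ρ).trace.re + u⁻¹ * (E * σ).trace.re := by
  obtain ⟨C, rfl⟩ := exists_eq_conjTranspose_mul_self hE
  have hs : √u ≠ 0 := (Real.sqrt_pos.2 hu).ne'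
  have h1 := h.two_mul_re_trace_le (√u • C.conjTranspose) ((√u)⁻¹ • C.conjTranspose)
  simp only [Matrix.conjTranspose_smul, Matrix.conjTranspose_conjTranspose, Matrix.smul_mul,
    Matrix.mul_smul, smul_smul, star_trivial, Real.mul_self_sqrt hu.le, ← mul_inv,
    inv_mul_cancel₀ hs, one_smul, Matrix.trace_smul, Complex.smul_re, smul_eq_mul] at h1
  simpa only [trace_conjTranspose_mul_self_mul] using h1

lemma re_trace_mul_add_re_trace_mul (hρ : IsState ρ) (hEF : E + F = 1) :
    (E * ρ).trace.re + (F * ρ).trace.re = 1 := by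
  rw [← Complex.add_re, ← Matrix.trace_add, ← Matrix.add_mul, hEF, Matrix.one_mul, hρ.2,
    Complex.one_re]

/-- A lower bound on the error probability of a symmetric test by the fidelity. -/
theorem rootFidelity_sq_le (hρ : IsState ρ) (hσ : IsState σ) (hE : E.PosSemidef)
    (hF : F.PosSemidef) (hEF : E + F = 1) {p : ℝ} (hp0 : 0 < p) (hp1 : p < 1) :
    p * (1 - p) * rootFidelity ρ σ ^ 2 ≤ p * (E * ρ).trace.re + (1 - p) * (F * σ).trace.re := by
  obtain ⟨Y, hY, hf⟩ := exists_isPosBlock_trace_eq_rootFidelity hρ.1 hσ.1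
  have hf0 := rootFidelity_nonneg hρ.1 σ
  set f := rootFidelity ρ σ
  have hq : 0 < 1 - p := sub_pos.2 hp1
  have h1 := re_trace_mul_add_re_trace_mul hρ hEF
  have h2 := re_trace_mul_add_re_trace_mul hσ hEF
  have ha := re_trace_mul_nonneg hE hρ.1
  have hb := re_trace_mul_nonneg hF hσ.1
  have h3 : (E * Y).trace.re + (F * Y).trace.re = f := by
    rw [← Complex.add_re, ← Matrix.trace_add, ← Matrix.add_mul, hEF, Matrix.one_mul, hf]
  rcases hf0.eq_or_lt with hf0 | hf0
  · rw [← hf0, sq, zero_mul, mul_zero]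
    exact add_nonneg (mul_nonneg hp0.le ha) (mul_nonneg hq.le hb)
  -- With this `c`, adding the bounds for `E` and `F` gives `2 f ≤ c e + f (1 - e)` for the error
  -- probability `e`, hence `f ≤ c e`.
  set c : ℝ := (p * (1 - p) * f)⁻¹ with hc
  have hc0 : 0 < c := by positivity
  have hcf : p * (1 - p) * f * c = 1 := mul_inv_cancel₀ (by positivity)
  have h4 := hY.two_mul_re_trace_mul_le hE (mul_pos hp0 hc0)
  have h5 := hY.two_mul_re_trace_mul_le hF (inv_pos.2 (mul_pos hq hc0))
  have i1 : (p * c)⁻¹ = (1 - p) * f := by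
    rw [hc]; field_simp
  have i2 : ((1 - p) * c)⁻¹ = p * f := by
    rw [hc]; field_simp
  rw [i1] at h4
  rw [inv_inv, i2] at h5
  set a := (E * ρ).trace.re
  set b := (F * σ).trace.re
  rw [show (F * ρ).trace.re = 1 - a by linarith] at h5
  rw [show (E * σ).trace.re = 1 - b by linarith] at h4
  have h6 : f ≤ c * (p * a + (1 - p) * b) := by
    nlinarith [mul_nonneg hf0.le (mul_nonneg hp0.le ha), mul_nonneg hf0.le (mul_nonneg hq.le hb)]
  calc p * (1 - p) * f ^ 2 = (p * (1 - p) * f) * f := by ring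
    _ ≤ (p * (1 - p) * f) * (c * (p * a + (1 - p) * b)) := by gcongr
    _ = p * a + (1 - p) * b := by rw [← mul_assoc, hcf, one_mul]

/-- A lower bound on the error probability of a symmetric test for dominated states. -/
theorem le_mul_of_smul_sub_posSemidef (hρ : IsState ρ) (hσ : IsState σ) (hE : E.PosSemidef)
    (hF : F.PosSemidef) (hEF : E + F = 1) {p : ℝ} (hp0 : 0 < p) (hp1 : p < 1) {c : ℝ}
    (h : (c • σ - ρ).PosSemidef) :
    p * (1 - p) ≤ c * (p * (E * ρ).trace.re + (1 - p) * (F * σ).trace.re) := by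
  have h1 := re_trace_mul_add_re_trace_mul hρ hEF
  have ha := re_trace_mul_nonneg hE hρ.1
  have hb := re_trace_mul_nonneg hF hρ.1
  have h3 := trace_re_nonneg h
  have h4 := re_trace_mul_nonneg hF h
  rw [Matrix.trace_sub, Matrix.trace_smul, hσ.2, hρ.2] at h3
  rw [Matrix.mul_sub, Matrix.mul_smul, Matrix.trace_sub, Matrix.trace_smul] at h4
  simp only [Complex.sub_re, Complex.smul_re, Complex.one_re, smul_eq_mul, mul_one] at h3 h4
  set a := (E * ρ).trace.re
  have hq : 0 < 1 - p := sub_pos.2 hp1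
  -- As `c ≥ 1` and `c Tr Fσ ≥ 1 - a`, the right side is at least `p a + (1 - p)(1 - a)`, which
  -- exceeds `p (1 - p)` by `p² a + (1 - p)² (1 - a)`.
  nlinarith [mul_nonneg hq.le h4, mul_nonneg (mul_nonneg hp0.le ha) h3,
    mul_nonneg (mul_nonneg hp0.le hp0.le) ha, mul_nonneg (mul_nonneg hq.le hq.le) hb]

end Measurement

/-! ### One-use consequences of the channel divergences -/

section Divergences

lemma sandwichedRenyi_half_of_pos {X : Type u} [Fintype X] [DecidableEq X] {ρ σ : Matrix X X ℂ}
    (hρ : ρ.PosSemidef) (hσ : σ.PosSemidef) (h : 0 < rootFidelity ρ σ) :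
    sandwichedRenyi (1 / 2) X ρ σ = ((-2 * Real.logb 2 (rootFidelity ρ σ) : ℝ) : EReal) := by
  have h0 : (ρ * σ).trace ≠ 0 := fun h0 => h.ne' ((rootFidelity_eq_zero_iff hρ hσ).2 h0)
  rw [sandwichedRenyi, if_pos (Or.inl ⟨by norm_num, by norm_num, h0⟩), rootFidelity]
  norm_num

lemma sandwichedRenyi_half_of_eq_zero {X : Type u} [Fintype X] [DecidableEq X]
    {ρ σ : Matrix X X ℂ} (hρ : ρ.PosSemidef) (hσ : σ.PosSemidef) (h : rootFidelity ρ σ = 0) :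
    sandwichedRenyi (1 / 2) X ρ σ = ⊤ := by
  rw [sandwichedRenyi, if_neg]
  rintro (⟨-, -, h0⟩ | ⟨h0, -⟩)
  · exact h0 ((rootFidelity_eq_zero_iff hρ hσ).1 h)
  · norm_num at h0

variable {A B : Type u} [Fintype A] [DecidableEq A] [Fintype B] [DecidableEq B]
  {N M : Matrix A A ℂ →ₗ[ℂ] Matrix B B ℂ} {r : ℕ} {ρ σ : Matrix (Fin r × A) (Fin r × A) ℂ} {x : ℝ}

lemma rootFidelity_mul_le_of_amortizedChannelDivergence_le (hN : IsChannel N) (hM : IsChannel M)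
    (h : amortizedChannelDivergence (sandwichedRenyi (1 / 2)) N M ≤ x) (hρ : IsState ρ)
    (hσ : IsState σ) :
    rootFidelity ρ σ * 2 ^ (-x / 2) ≤ rootFidelity (idTensor N ρ) (idTensor M σ) := by
  have hρ' := (hN.isState_idTensor hρ).1
  have hσ' := (hM.isState_idTensor hσ).1
  have hf := rootFidelity_nonneg hρ' (idTensor M σ)
  rcases (rootFidelity_nonneg hρ.1 σ).eq_or_lt with h0 | h0
  · rwa [← h0, zero_mul]
  have h1 : sandwichedRenyi (1 / 2) (Fin r × B) (idTensor N ρ) (idTensor M σ) -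
      sandwichedRenyi (1 / 2) (Fin r × A) ρ σ ≤ x := by
    simp only [amortizedChannelDivergence, iSup_le_iff] at h
    exact h r ρ σ hρ hσ
  -- Orthogonal outputs from non-orthogonal inputs would make the divergence infinite, against the
  -- real bound `x`.
  rw [sandwichedRenyi_half_of_pos hρ.1 hσ.1 h0] at h1
  rcases hf.eq_or_lt with hf | hf
  · rw [sandwichedRenyi_half_of_eq_zero hρ' hσ' hf.symm, EReal.top_sub_coe] at h1
    exact absurd h1 (EReal.coe_lt_top x).not_ge
  rw [sandwichedRenyi_half_of_pos hρ' hσ' hf, ← EReal.coe_sub, EReal.coe_le_coe_iff] at h1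
  rw [← Real.logb_le_logb one_lt_two (by positivity) hf, Real.logb_mul h0.ne' (by positivity),
    Real.logb_rpow two_pos one_lt_two.ne']
  linarith

/-- Strictness supplies an admissible exponent below `x`, so the infimum need not be attained. -/
lemma posSemidef_of_channelDivergence_lt (hM : IsChannel M)
    (h : channelDivergence maxRelEntropy N M < x) (hρ : IsState ρ) :
    ((2 : ℝ) ^ x • idTensor M ρ - idTensor N ρ).PosSemidef := by
  have h1 : maxRelEntropy (Fin r × B) (idTensor N ρ) (idTensor M ρ) < x := by
    refine lt_of_le_of_lt ?_ h
    have h0 := le_refl (channelDivergence maxRelEntropy N M)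
    nth_rw 1 [channelDivergence] at h0
    simp only [iSup_le_iff] at h0
    exact h0 r ρ hρ
  simp only [maxRelEntropy, iInf_lt_iff] at h1
  obtain ⟨y, hy, hyx⟩ := h1
  have hyx' : (2 : ℝ) ^ y ≤ 2 ^ x :=
    Real.rpow_le_rpow_of_exponent_le one_le_two (EReal.coe_lt_coe_iff.1 hyx).le
  have := ((hM.isState_idTensor hρ).1.smul (sub_nonneg.2 hyx')).add hy
  rwa [sub_smul, sub_add_sub_cancel] at this

end Divergences

/-! ### Propagation along an adaptive protocol -/

namespace Protocol

variable {A B : Type u} [Fintype A] [DecidableEq A] [Fintype B] [DecidableEq B] {n : ℕ}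
  {N M : Matrix A A ℂ →ₗ[ℂ] Matrix B B ℂ} (P : Protocol A B n)

lemma isState_stateBefore (hN : IsChannel N) {i : ℕ} (hi : i < n) :
    IsState (P.stateBefore N i) := by
  induction i with
  | zero => exact P.init_isState
  | succ i ih =>
    exact (P.adapt_isChannel i hi).isState_apply
      (hN.isState_idTensor (ih (Nat.lt_of_succ_lt hi)))

lemma isState_finalState (hN : IsChannel N) (hn : 1 ≤ n) : IsState (P.finalState N) :=
  hN.isState_idTensor (P.isState_stateBefore hN (Nat.sub_one_lt_of_lt hn))

lemma le_rootFidelity_stateBefore (hN : IsChannel N) (hM : IsChannel M) {x : ℝ}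
    (h : amortizedChannelDivergence (sandwichedRenyi (1 / 2)) N M ≤ x) {i : ℕ} (hi : i < n) :
    ((2 : ℝ) ^ (-x / 2)) ^ i ≤ rootFidelity (P.stateBefore N i) (P.stateBefore M i) := by
  induction i with
  | zero =>
    have := rootFidelity_self P.init_isState.1
    rwa [P.init_isState.2, Complex.one_re] at this
  | succ i ih =>
    have hi' := Nat.lt_of_succ_lt hi
    have h1 := P.isState_stateBefore hN hi'
    have h2 := P.isState_stateBefore hM hi'
    refine le_trans ?_ ((P.adapt_isChannel i hi).rootFidelity_le (hN.isState_idTensor h1).1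
      (hM.isState_idTensor h2).1)
    refine le_trans ?_ (rootFidelity_mul_le_of_amortizedChannelDivergence_le hN hM h h1 h2)
    rw [pow_succ]
    gcongr
    exact ih hi'

lemma le_rootFidelity_finalState (hN : IsChannel N) (hM : IsChannel M) {x : ℝ}
    (h : amortizedChannelDivergence (sandwichedRenyi (1 / 2)) N M ≤ x) (hn : 1 ≤ n) :
    ((2 : ℝ) ^ (-x / 2)) ^ n ≤ rootFidelity (P.finalState N) (P.finalState M) := by
  have hn' := Nat.sub_one_lt_of_lt hn
  refine le_trans ?_ (rootFidelity_mul_le_of_amortizedChannelDivergence_le hN hM h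
    (P.isState_stateBefore hN hn') (P.isState_stateBefore hM hn'))
  -- Before the last use, `n - 1` factors have accrued; that use adds one more.
  rw [← pow_sub_one_mul (by omega : n ≠ 0)]
  gcongr
  exact P.le_rootFidelity_stateBefore hN hM h hn'

lemma posSemidef_stateBefore (hN : IsChannel N) (hM : IsChannel M) {x : ℝ}
    (h : channelDivergence maxRelEntropy N M < x) {i : ℕ} (hi : i < n) :
    (((2 : ℝ) ^ x) ^ i • P.stateBefore M i - P.stateBefore N i).PosSemidef := by
  induction i with
  | zero =>
    simpa [stateBefore] using Matrix.PosSemidef.zero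
  | succ i ih =>
    have hi' := Nat.lt_of_succ_lt hi
    have h1 := (P.adapt_isChannel i hi).1.posSemidef_apply
      (hM.smul_idTensor_sub_posSemidef (ih hi') (posSemidef_of_channelDivergence_lt hM h
        (P.isState_stateBefore hN hi')) (by positivity))
    rwa [map_sub, LinearMap.map_smul_of_tower, ← pow_succ] at h1

lemma posSemidef_finalState (hN : IsChannel N) (hM : IsChannel M) {x : ℝ}
    (h : channelDivergence maxRelEntropy N M < x) (hn : 1 ≤ n) :
    (((2 : ℝ) ^ x) ^ n • P.finalState M - P.finalState N).PosSemidef := by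
  have hn' := Nat.sub_one_lt_of_lt hn
  have h1 := hM.smul_idTensor_sub_posSemidef (P.posSemidef_stateBefore hN hM h hn')
    (posSemidef_of_channelDivergence_lt hM h (P.isState_stateBefore hN hn')) (by positivity)
  rwa [pow_sub_one_mul (by omega : n ≠ 0)] at h1

end Protocol

/-! ### From error bounds to exponents -/

section ErrorExponent

variable {A B : Type u} [Fintype A] [DecidableEq A] [Fintype B] [DecidableEq B]
  {N M : Matrix A A ℂ →ₗ[ℂ] Matrix B B ℂ} {n : ℕ} {p : ℝ}

lemma neg_mul_elog2_le (hn : 1 ≤ n) {k e x : ℝ} (hk : 0 < k) (h : k ≤ ((2 : ℝ) ^ x) ^ n * e) :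
    -(((1 / (n : ℝ) : ℝ) : EReal) * elog2 e) ≤
      (x : EReal) - ((1 / (n : ℝ) * Real.logb 2 k : ℝ) : EReal) := by
  have hn' : (0 : ℝ) < n := by exact_mod_cast hn
  -- The error is positive, so the `-∞` branch of `elog2` is excluded.
  have he : 0 < e := pos_of_mul_pos_right (hk.trans_le h) (by positivity)
  rw [elog2, if_neg he.not_ge, ← EReal.coe_mul, ← EReal.coe_neg, ← EReal.coe_sub,
    EReal.coe_le_coe_iff]
  have h1 := (Real.logb_le_logb one_lt_two hk (hk.trans_le h)).2 h
  rw [Real.logb_mul (by positivity) he.ne', Real.logb_pow, Real.logb_rpow two_pos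
    one_lt_two.ne'] at h1
  have h2 := mul_le_mul_of_nonneg_left h1 (one_div_pos.2 hn').le
  rw [mul_add, ← mul_assoc, one_div_mul_cancel hn'.ne', one_mul] at h2
  linarith

/-- Comparing with every real `x > D` treats finite and infinite `D` alike. -/
lemma symmetricErrorExponent_le_sub (hn : 1 ≤ n) (hp0 : 0 < p) (hp1 : p < 1) {D : EReal}
    (h : ∀ (x : ℝ) (P : Protocol A B n), D < x →
      p * (1 - p) ≤ ((2 : ℝ) ^ x) ^ n * (p * P.typeIError N + (1 - p) * P.typeIIError M)) :
    symmetricErrorExponent n p N M ≤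
      D - ((1 / (n : ℝ) * Real.logb 2 (p * (1 - p)) : ℝ) : EReal) := by
  refine iSup_le fun P => ?_
  rw [EReal.le_sub_iff_add_le (Or.inl (EReal.coe_ne_bot _)) (Or.inl (EReal.coe_ne_top _)),
    ← EReal.le_of_forall_lt_iff_le]
  exact fun x hx => EReal.add_le_of_le_sub
    (neg_mul_elog2_le hn (mul_pos hp0 (sub_pos.2 hp1)) (h x P hx))

end ErrorExponent

end ChannelDiscrimination

theorem mainTheorem12 {A B : Type u} [Fintype A] [DecidableEq A] [Fintype B] [DecidableEq B]
    (N M : Matrix A A ℂ →ₗ[ℂ] Matrix B B ℂ)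
    (hN : ChannelDiscrimination.IsChannel N) (hM : ChannelDiscrimination.IsChannel M)
    (p : ℝ) (hp0 : 0 < p) (hp1 : p < 1) (n : ℕ) (hn : 1 ≤ n) :
    ChannelDiscrimination.symmetricErrorExponent n p N M ≤
      min (ChannelDiscrimination.amortizedChannelDivergence
            (ChannelDiscrimination.sandwichedRenyi (1 / 2)) N M)
        (min (ChannelDiscrimination.channelDivergence ChannelDiscrimination.maxRelEntropy N M)
          (ChannelDiscrimination.channelDivergence ChannelDiscrimination.maxRelEntropy M N))
      - ((1 / (n : ℝ) * Real.logb 2 (p * (1 - p)) : ℝ) : EReal) := by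
  refine ChannelDiscrimination.symmetricErrorExponent_le_sub hn hp0 hp1 fun x P hx => ?_
  have hρ := P.isState_finalState hN hn
  have hτ := P.isState_finalState hM hn
  have hpp : 0 ≤ p * (1 - p) := mul_nonneg hp0.le (sub_pos.2 hp1).le
  rcases min_lt_iff.1 hx with hx | hx
  · have h1 := P.le_rootFidelity_finalState hN hM hx.le hn
    have h2 := ChannelDiscrimination.rootFidelity_sq_le hρ hτ P.Q_le_one P.Q_nonneg
      (sub_add_cancel _ _) hp0 hp1
    have h3 : ((2 : ℝ) ^ x) ^ n * (((2 : ℝ) ^ (-x / 2)) ^ n) ^ 2 = 1 := by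
      rw [pow_right_comm, ← mul_pow, ← Real.rpow_natCast _ 2, ← Real.rpow_mul two_pos.le,
        ← Real.rpow_add two_pos, Nat.cast_two, div_mul_cancel₀ _ two_ne_zero, add_neg_cancel,
        Real.rpow_zero, one_pow]
    calc p * (1 - p) = ((2 : ℝ) ^ x) ^ n * (p * (1 - p) * (((2 : ℝ) ^ (-x / 2)) ^ n) ^ 2) := by
          rw [mul_left_comm, h3, mul_one]
      _ ≤ _ := by
        refine mul_le_mul_of_nonneg_left (le_trans ?_ h2) (by positivity)
        gcongr
  rcases min_lt_iff.1 hx with hx | hx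
  · exact ChannelDiscrimination.le_mul_of_smul_sub_posSemidef hρ hτ P.Q_le_one P.Q_nonneg
      (sub_add_cancel _ _) hp0 hp1 (P.posSemidef_finalState hN hM hx hn)
  -- The hypotheses, the outcomes and the priors `p`, `1 - p` are exchanged; the error probability
  -- is unchanged.
  · have h := ChannelDiscrimination.le_mul_of_smul_sub_posSemidef hτ hρ P.Q_nonneg P.Q_le_one
      (add_sub_cancel _ _) (sub_pos.2 hp1) (sub_lt_self 1 hp0)
      (P.posSemidef_finalState hM hN hx hn)
    rwa [sub_sub_cancel, mul_comm (1 - p) p, add_comm ((1 - p) * _)] at h
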